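/- Let $0<\alpha\le 1$ and let $G_\alpha$ be $\mathbb{R}^3$ with the group law $(x,y,z)\ast(x',y',z')=(x'e^{z}+x,\;y'e^{-\alpha z}+y,\;z'+z)$ and the left-invariant Riemannian metric $ds^2=e^{-2z}dx^2+e^{2\alpha z}dy^2+dz^2$. For a geodesic $\gamma$ of $G_\alpha$ parametrized by arc length, let $u(t)$ be the vector $\gamma'(t)$ carried by left translation to the Lie algebra $T_0G_\alpha=\mathbb{R}^3$; this is a curve on the unit sphere $S$, and the curves $u$ are the flowlines of a flow on $S$. The period $P(V)\in(0,\infty]$ of $V=(V_1,V_2,V_3)\in S$ is defined as follows. * If $V_1V_2=0$ then $P(V)=\infty$. * If $V_1V_2\ne0$ and $V$ is not one of the four stationary points $\left(\pm\sqrt{\tfrac{\alpha}{1+\alpha}},\pm\tfrac{1}{\sqrt{1+\alpha}},0\right)$, then $V$ lies on a closed orbit of the flow, and $P(V)$ is the time in which the flow goes exactly once around this orbit. * If $V$ is one of these four stationary points (the directions of the straight-line geodesics outside the planes $x=0$ and $y=0$), then $P(V)=\lim_{\beta\to1^-}P(V_\beta)$, where $V_\beta=\left(\beta\sqrt{\tfrac{\alpha}{1+\alpha}},\tfrac{\beta}{\sqrt{1+\alpha}},\sqrt{1-\beta^2}\right)$.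 A geodesic segment $\gamma:[a,b]\to G_\alpha$ parametrized by arc length is called large if its length $b-a$ is greater than $P(u(a))$. Then, for every $0<\alpha\le1$, a large geodesic segment of $G_\alpha$ is not a length minimizer: there is a $C^1$ curve with the same endpoints that is strictly shorter. -/

import Mathlib

open scoped ENNReal
open Filter Topology

noncomputable section

namespace SolFamily

/-- The underlying set `ℝ³` of the group `G_α`, with coordinates `(x, y, z) = (p 0, p 1, p 2)`.
It is also the underlying set of the Lie algebra. The identity element is `0`. -/
abbrev Pt : Type := Fin 3 → ℝ

/-- The group law `(x,y,z) * (x',y',z') = (x' e^z + x, y' e^{-αz} + y, z' + z)` of `G_α`. -/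
def mul (α : ℝ) (p q : Pt) : Pt :=
  ![q 0 * Real.exp (p 2) + p 0, q 1 * Real.exp (-α * p 2) + p 1, q 2 + p 2]

/-- The inverse in `G_α`. -/
def inv (α : ℝ) (p : Pt) : Pt :=
  ![-(p 0 * Real.exp (-p 2)), -(p 1 * Real.exp (α * p 2)), -p 2]

theorem inv_mul (α : ℝ) (p : Pt) : mul α (inv α p) p = 0 := by
  ext i
  fin_cases i <;> simp [mul, inv]

/-- The Gram matrix of the left-invariant metric
`ds² = e^{-2z} dx² + e^{2αz} dy² + dz²` in the coordinates `(x, y, z)`. -/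
def metric (α : ℝ) (p : Pt) : Matrix (Fin 3) (Fin 3) ℝ :=
  Matrix.diagonal ![Real.exp (-2 * p 2), Real.exp (2 * α * p 2), 1]

/-- The Riemannian norm of the tangent vector `v` at the point `p`. -/
def tangentNorm (α : ℝ) (p v : Pt) : ℝ :=
  √(∑ i, ∑ j, metric α p i j * v i * v j)

/-- The coordinate partial derivative `∂f/∂xⁱ` at `p`. -/
def partialDeriv (i : Fin 3) (f : Pt → ℝ) (p : Pt) : ℝ :=
  fderiv ℝ f p (Pi.single i 1)

/-- The Christoffel symbol `Γᵏᵢⱼ` of the Levi-Civita connection, at the point `p`: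
`Γᵏᵢⱼ = ½ ∑ₗ gᵏˡ (∂ᵢ gⱼₗ + ∂ⱼ gᵢₗ - ∂ₗ gᵢⱼ)`. -/
def christoffel (α : ℝ) (k i j : Fin 3) (p : Pt) : ℝ :=
  (1 / 2) * ∑ l, (metric α p)⁻¹ k l *
    (partialDeriv i (fun q => metric α q j l) p + partialDeriv j (fun q => metric α q i l) p
      - partialDeriv l (fun q => metric α q i j) p)

/-- `γ` restricted to `[a, b]` is a geodesic segment of `G_α` parametrized by arc length: on some
open set containing `[a, b]`, the curve `γ` is twice continuously differentiable, has unit speed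
and solves the geodesic equation. -/
def IsGeodesicSegment (α : ℝ) (γ : ℝ → Pt) (a b : ℝ) : Prop :=
  ∃ I : Set ℝ, IsOpen I ∧ Set.Icc a b ⊆ I ∧ ContDiffOn ℝ 2 γ I ∧
    ∀ t ∈ I, tangentNorm α (γ t) (deriv γ t) = 1 ∧
      ∀ k, deriv (deriv γ) t k
        + ∑ i, ∑ j, christoffel α k i j (γ t) * deriv γ t i * deriv γ t j = 0

/-- The length of `γ` between the times `a` and `b`. -/
def length (α : ℝ) (γ : ℝ → Pt) (a b : ℝ) : ℝ :=
  ∫ t in a..b, tangentNorm α (γ t) (deriv γ t)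

/-- `γ` restricted to `[a, b]` is a length minimizer: no `C¹` curve with the same endpoints is
shorter. (Competitors may have zero speed at some times, so that broken `C¹` curves are covered
after a reparametrization.) -/
def IsLengthMinimizer (α : ℝ) (γ : ℝ → Pt) (a b : ℝ) : Prop :=
  ∀ σ : ℝ → Pt, ContDiffOn ℝ 1 σ (Set.Icc a b) → σ a = γ a → σ b = γ b →
    length α γ a b ≤ length α σ a b

/-- The development of the velocity of `γ`: the vector `γ'(t)` carried to the Lie algebra
(the tangent space at the identity) by the left translation by `γ(t)⁻¹`. For a geodesic of unit
speed it is a flowline on the unit sphere of the Lie algebra. -/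
def development (α : ℝ) (γ : ℝ → Pt) (t : ℝ) : Pt :=
  fderiv ℝ (mul α (inv α (γ t))) (γ t) (deriv γ t)

/-- The first return time of the flowline through the unit vector `V`: the infimum of the `τ > 0`
such that the development of the geodesic leaving the identity with velocity `V` is back at `V`
at time `τ`. It is `⊤` if there is no such `τ`. -/
def returnTime (α : ℝ) (V : Pt) : ℝ≥0∞ :=
  ⨅ (τ : ℝ) (_ : 0 < τ ∧ ∃ γ : ℝ → Pt, IsGeodesicSegment α γ 0 τ ∧ γ 0 = 0 ∧
    development α γ 0 = V ∧ development α γ τ = V), ENNReal.ofReal τ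

/-- The unit vector `V_β = (β √(α/(1+α)), β/√(1+α), √(1-β²))`, for `0 ≤ β ≤ 1`. -/
def unitVec (α β : ℝ) : Pt :=
  ![β * √(α / (1 + α)), β / √(1 + α), √(1 - β ^ 2)]

/-- The initial directions `(±√(α/(1+α)), ±1/√(1+α), 0)` of the straight-line geodesics outside
the planes `X = 0` and `Y = 0`; the flow on the unit sphere is stationary there. -/
def IsStraight (α : ℝ) (V : Pt) : Prop :=
  |V 0| = unitVec α 1 0 ∧ |V 1| = unitVec α 1 1 ∧ V 2 = 0

open Classical in
/-- The period `P` of a unit vector `V` of the Lie algebra.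
* If `V` lies in one of the planes `X = 0`, `Y = 0`, it is on no loop level set and `P = ⊤`.
* If `V` is the direction of a straight-line geodesic, its loop is degenerate and `P` is the limit
  of the periods of the nearby loops, `lim_{β → 1⁻} P(V_β)` (written as a lower limit, which is
  always defined).
* Otherwise `V` is on a loop level set, and `P` is the time to go exactly once around it. -/
def period (α : ℝ) (V : Pt) : ℝ≥0∞ :=
  if V 0 = 0 ∨ V 1 = 0 then ⊤
  else if IsStraight α V then liminf (fun β : ℝ => returnTime α (unitVec α β)) (𝓝[<] 1)
  else returnTime α V

/-- The segment of `γ` over `[a, b]` is large: its length exceeds the period of its initial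
velocity. -/
def IsLarge (α : ℝ) (γ : ℝ → Pt) (a b : ℝ) : Prop :=
  period α (development α γ a) < ENNReal.ofReal (length α γ a b)

end SolFamily

end

noncomputable section

namespace SolFamily

/-! Along a geodesic with height `z` the development `u` is an integral curve of `field`, and `u 0 *
exp (-z)` and `u 1 * exp (α z)` are constant. So if `u 0 ≠ 0` and `u` returns after time `τ`, the
height returns too, while `x` and `y` drift.

Non-straight case, `τ < b - a`. Choose a time `c` with `u 2 ≠ 0` and put `d = c + τ < b`. A
half-turn about a vertical line, combined with time reversal, preserves length and turns the arc
over `[c, d]` into another arc with the same endpoints (`mirror`). It reaches `γ d` with the third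
velocity component reversed, so continuing along `γ` makes a genuine corner, and cutting this corner
saves length (`exists_joins_of_corner`).

Straight case. The mirror arc has no corner, so the second variation is used instead: an oscillation
of frequency `2π / L` about a straight segment of length `L` shortens it once `(2π / L)² < 2α`
(`length_wave_lt`). It remains to see that the limit of the periods is at least `2π / √(2α)`. On a
flowline `u 2` satisfies `w'' = -q w` with `q = 2 (u 0)² + 2 α² (u 1)²`. If `w` has mean zero over a
return time `τ` and `q ≤ M`, Wirtinger's inequality gives `(2π / τ)² ≤ M` (`le_of_return`), and `M`
can be taken close to `2α` near the stationary point. No exact period is computed. -/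

variable {α : ℝ}

/-! ### Norms, lengths and concatenation of curves -/

theorem tangentNorm_eq (α : ℝ) (p v : Pt) :
    tangentNorm α p v =
      √(Real.exp (-2 * p 2) * v 0 ^ 2 + Real.exp (2 * α * p 2) * v 1 ^ 2 + v 2 ^ 2) := by
  simp only [tangentNorm, metric, Fin.sum_univ_three, Matrix.diagonal_apply]
  congr 1
  simp
  ring

theorem tangentNorm_nonneg (α : ℝ) (p v : Pt) : 0 ≤ tangentNorm α p v := Real.sqrt_nonneg _

theorem tangentNorm_smul {r : ℝ} (hr : 0 ≤ r) (p v : Pt) :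
    tangentNorm α p (r • v) = r * tangentNorm α p v := by
  rw [tangentNorm_eq, tangentNorm_eq]
  simp only [Pi.smul_apply, smul_eq_mul]
  rw [← Real.sqrt_sq hr, ← Real.sqrt_mul (sq_nonneg r), Real.sqrt_sq hr]
  congr 1
  ring

theorem continuous_tangentNorm (α : ℝ) :
    Continuous fun x : Pt × Pt => tangentNorm α x.1 x.2 := by
  simp only [tangentNorm_eq]
  fun_prop

theorem continuousOn_tangentNorm {f g : ℝ → Pt} {s : Set ℝ} (hf : ContinuousOn f s)
    (hg : ContinuousOn g s) : ContinuousOn (fun t => tangentNorm α (f t) (g t)) s := by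
  have hf' := continuousOn_pi.1 hf
  have hg' := continuousOn_pi.1 hg
  have h0 := hg' 0
  have h1 := hg' 1
  have h2 := hg' 2
  have h3 := hf' 2
  simp only [tangentNorm_eq]
  fun_prop

theorem length_nonneg (α : ℝ) (γ : ℝ → Pt) {a b : ℝ} (hab : a ≤ b) : 0 ≤ length α γ a b :=
  intervalIntegral.integral_nonneg hab fun _ _ => tangentNorm_nonneg _ _ _

/-- Invariance of the length under monotone reparametrization. -/
theorem length_comp {γ : ℝ → Pt} {I : Set ℝ} (hI : IsOpen I) (hγ : ContDiffOn ℝ 1 γ I)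
    {h : ℝ → ℝ} (hh : ContDiff ℝ 1 h) (hm : Monotone h) {s t : ℝ}
    (hI' : h '' Set.uIcc s t ⊆ I) :
    length α (γ ∘ h) s t = length α γ (h s) (h t) := by
  have hd : ∀ x, HasDerivAt h (deriv h x) x := fun x =>
    (hh.differentiable one_ne_zero x).hasDerivAt
  have hcd : ContinuousOn (deriv γ) I := (contDiffOn_succ_iff_deriv_of_isOpen (n := 0) hI).1
    (by simpa using hγ) |>.2.2.continuousOn
  unfold length
  rw [← intervalIntegral.integral_comp_mul_deriv'' (f := h) (f' := deriv h)
    hh.continuous.continuousOn (fun x _ => (hd x).hasDerivWithinAt)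
    (hh.continuous_deriv le_rfl).continuousOn]
  · refine intervalIntegral.integral_congr fun x hx => ?_
    have hxI := hI' ⟨x, hx, rfl⟩
    have : HasDerivAt γ (deriv γ (h x)) (h x) :=
      ((hγ.differentiableOn one_ne_zero).differentiableAt (hI.mem_nhds hxI)).hasDerivAt
    simp only [Function.comp_apply]
    rw [(this.scomp x (hd x)).deriv, tangentNorm_smul hm.deriv_nonneg, mul_comm]
  · exact continuousOn_tangentNorm (hγ.continuousOn.mono hI') (hcd.mono hI')

/-- There is a `C¹` curve of length `ℓ` from `p` to `q`. -/
def Joins (α : ℝ) (p q : Pt) (ℓ : ℝ) : Prop :=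
  ∃ σ : ℝ → Pt, ContDiff ℝ 1 σ ∧ σ 0 = p ∧ σ 1 = q ∧ length α σ 0 1 = ℓ

/-- Reparametrizing by a smooth step that is constant outside `[0, 1]` makes the curve globally `C¹`
without changing its length. -/
theorem joins_of_contDiffOn {γ : ℝ → Pt} {I : Set ℝ} (hI : IsOpen I) (hγ : ContDiffOn ℝ 1 γ I)
    {a b : ℝ} (hab : a ≤ b) (hI' : Set.Icc a b ⊆ I) :
    Joins α (γ a) (γ b) (length α γ a b) := by
  set h : ℝ → ℝ := fun t => a + (b - a) * Real.smoothTransition t with hh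
  have hc : ContDiff ℝ 1 h :=
    contDiff_const.add (contDiff_const.mul (Real.smoothTransition.contDiff (n := 1)))
  have hm : Monotone h := fun x y hxy => by
    have := mul_le_mul_of_nonneg_left (Real.smoothTransition.monotone hxy) (sub_nonneg.2 hab)
    simpa [hh] using this
  have hr : ∀ t, h t ∈ I := fun t => hI' ⟨by
    have := mul_nonneg (sub_nonneg.2 hab) (Real.smoothTransition.nonneg t)
    simp only [hh]; linarith, by
    have := mul_le_mul_of_nonneg_left (Real.smoothTransition.le_one t) (sub_nonneg.2 hab)
    simp only [hh]; linarith⟩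
  have h0 : h 0 = a := by simp [hh]
  have h1 : h 1 = b := by simp [hh]
  refine ⟨γ ∘ h, ?_, by simp [h0], by simp [h1], ?_⟩
  · exact contDiffOn_univ.1 (hγ.comp hc.contDiffOn fun t _ => hr t)
  · rw [length_comp hI hγ hc hm (by rintro _ ⟨x, -, rfl⟩; exact hr x), h0, h1]

/-- Both curves are slowed to a stop at the junction, so the sum `σ₁ ∘ f + σ₂ ∘ g - σ₁ 1` is `C¹`
even where the two velocities disagree. -/
theorem Joins.trans {p q r : Pt} {ℓ₁ ℓ₂ : ℝ} (h₁ : Joins α p q ℓ₁) (h₂ : Joins α q r ℓ₂) :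
    Joins α p r (ℓ₁ + ℓ₂) := by
  obtain ⟨σ₁, hσ₁, rfl, rfl, rfl⟩ := h₁
  obtain ⟨σ₂, hσ₂, h0, rfl, rfl⟩ := h₂
  set S := Real.smoothTransition
  have hS : ContDiff ℝ 1 S := Real.smoothTransition.contDiff
  set f : ℝ → ℝ := fun t => S (2 * t) with hf
  set g : ℝ → ℝ := fun t => S (2 * t - 1) with hg
  have hfc : ContDiff ℝ 1 f := hS.comp (by fun_prop)
  have hgc : ContDiff ℝ 1 g := hS.comp (by fun_prop)
  have hfm : Monotone f := fun x y hxy => Real.smoothTransition.monotone (by linarith)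
  have hgm : Monotone g := fun x y hxy => Real.smoothTransition.monotone (by linarith)
  have d1 : ∀ t, HasDerivAt (σ₁ ∘ f) (deriv (σ₁ ∘ f) t) t := fun t =>
    ((hσ₁.comp hfc).differentiable one_ne_zero t).hasDerivAt
  have d2 : ∀ t, HasDerivAt (σ₂ ∘ g) (deriv (σ₂ ∘ g) t) t := fun t =>
    ((hσ₂.comp hgc).differentiable one_ne_zero t).hasDerivAt
  have dσ : ∀ t, deriv (fun t => σ₁ (f t) + σ₂ (g t) - σ₁ 1) t =
      deriv (σ₁ ∘ f) t + deriv (σ₂ ∘ g) t := fun t =>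
    (((d1 t).add (d2 t)).sub_const _).deriv
  -- For `t ≤ 1/2` the function `g` is at its global minimum, which kills its derivative at the
  -- junction `t = 1/2` as well; for `f` below it is a maximum.
  have z2 : ∀ t ≤ (1 / 2 : ℝ), deriv (σ₂ ∘ g) t = 0 := fun t ht => by
    have hm : IsLocalMin g t := Filter.Eventually.of_forall fun x => by
      have : g t = 0 := Real.smoothTransition.zero_of_nonpos (by linarith)
      rw [this]; exact Real.smoothTransition.nonneg _
    have hg' : HasDerivAt g 0 t := by
      simpa [hm.deriv_eq_zero] using (hgc.differentiable one_ne_zero t).hasDerivAt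
    simpa using ((hσ₂.differentiable one_ne_zero (g t)).hasDerivAt.scomp t hg').deriv
  have z1 : ∀ t ≥ (1 / 2 : ℝ), deriv (σ₁ ∘ f) t = 0 := fun t ht => by
    have hm : IsLocalMax f t := Filter.Eventually.of_forall fun x => by
      have : f t = 1 := Real.smoothTransition.one_of_one_le (by linarith)
      rw [this]; exact Real.smoothTransition.le_one _
    have hf' : HasDerivAt f 0 t := by
      simpa [hm.deriv_eq_zero] using (hfc.differentiable one_ne_zero t).hasDerivAt
    simpa using ((hσ₁.differentiable one_ne_zero (f t)).hasDerivAt.scomp t hf').deriv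
  have hσ : ContDiff ℝ 1 fun t => σ₁ (f t) + σ₂ (g t) - σ₁ 1 :=
    ((hσ₁.comp hfc).add (hσ₂.comp hgc)).sub contDiff_const
  have f0 : f 0 = 0 := by simp [hf, S]
  have g0 : g 0 = 0 := Real.smoothTransition.zero_of_nonpos (by norm_num)
  have f1 : f 1 = 1 := Real.smoothTransition.one_of_one_le (by norm_num)
  have g1 : g 1 = 1 := Real.smoothTransition.one_of_one_le (by norm_num)
  have fh : f (1 / 2) = 1 := Real.smoothTransition.one_of_one_le (by norm_num)
  have gh : g (1 / 2) = 0 := Real.smoothTransition.zero_of_nonpos (by norm_num)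
  refine ⟨_, hσ, by simp [f0, g0, h0], by simp [f1, g1], ?_⟩
  have hint : ∀ s t : ℝ, IntervalIntegrable (fun t => tangentNorm α (σ₁ (f t) + σ₂ (g t) - σ₁ 1)
      (deriv (fun t => σ₁ (f t) + σ₂ (g t) - σ₁ 1) t)) MeasureTheory.volume s t := fun s t =>
    (continuousOn_tangentNorm hσ.continuous.continuousOn
      (hσ.continuous_deriv le_rfl).continuousOn).intervalIntegrable
  unfold length
  rw [← intervalIntegral.integral_add_adjacent_intervals (hint 0 (1 / 2)) (hint (1 / 2) 1)]
  congr 1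
  · have := length_comp (α := α) isOpen_univ hσ₁.contDiffOn hfc hfm
      (s := 0) (t := 1 / 2) (Set.subset_univ _)
    rw [f0, fh] at this
    refine Eq.trans ?_ this
    refine intervalIntegral.integral_congr fun t ht => ?_
    rw [Set.uIcc_of_le (by norm_num)] at ht
    have hgt : g t = 0 := Real.smoothTransition.zero_of_nonpos (by linarith [ht.2])
    simp only [dσ, z2 t ht.2, hgt, h0, add_zero, add_sub_cancel_right, Function.comp_apply]
  · have := length_comp (α := α) isOpen_univ hσ₂.contDiffOn hgc hgm
      (s := 1 / 2) (t := 1) (Set.subset_univ _)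
    rw [g1, gh] at this
    refine Eq.trans ?_ this
    refine intervalIntegral.integral_congr fun t ht => ?_
    rw [Set.uIcc_of_le (by norm_num)] at ht
    have hft : f t = 1 := Real.smoothTransition.one_of_one_le (by linarith [ht.1])
    simp only [dσ, z1 t ht.1, hft, zero_add, add_sub_cancel_left, Function.comp_apply]

theorem IsLengthMinimizer.length_le {γ : ℝ → Pt} {a b ℓ : ℝ} (h : IsLengthMinimizer α γ a b)
    (hab : a < b) (hj : Joins α (γ a) (γ b) ℓ) : length α γ a b ≤ ℓ := by
  obtain ⟨σ, hσ, h0, h1, rfl⟩ := hj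
  set f : ℝ → ℝ := fun t => (t - a) / (b - a) with hf
  have hfc : ContDiff ℝ 1 f := by fun_prop
  have hba : 0 < b - a := sub_pos.2 hab
  have hfm : Monotone f := fun x y hxy => by simp only [hf]; gcongr
  have fa : f a = 0 := by simp [hf]
  have fb : f b = 1 := by simp only [hf]; field_simp
  have := h (σ ∘ f) (hσ.comp hfc).contDiffOn (by simp [fa, h0]) (by simp [fb, h1])
  rwa [length_comp isOpen_univ hσ.contDiffOn hfc hfm (Set.subset_univ _), fa, fb] at this

/-! ### Cutting a corner -/

/-- The straight chords of a corner are asymptotically shorter than the two sides. -/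
theorem exists_joins_of_corner {γ σ : ℝ → Pt} {c : ℝ} {v w : Pt} (hσ : HasDerivAt σ v c)
    (hγ : HasDerivAt γ w c) (hc : σ c = γ c) (hlt : tangentNorm α (γ c) (v + w) < 2) :
    ∀ᶠ δ in 𝓝[>] (0 : ℝ), ∃ ℓ < 2 * δ, Joins α (σ (c - δ)) (γ (c + δ)) ℓ := by
  obtain ⟨m, hm, hm2⟩ := exists_between hlt
  have hD : HasDerivAt (fun δ => γ (c + δ) - σ (c - δ)) (v + w) 0 := by
    have h1 : HasDerivAt (fun δ => γ (c + δ)) w 0 := by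
      have := hγ.scomp_of_eq (x := (0 : ℝ)) (h := fun δ => c + δ) (h' := 1)
        ((hasDerivAt_id 0).const_add c) (by simp)
      simpa [Function.comp_def] using this
    have h2 : HasDerivAt (fun δ => σ (c - δ)) (-v) 0 := by
      have := hσ.scomp_of_eq (x := (0 : ℝ)) (h := fun δ => c - δ) (h' := -1)
        ((hasDerivAt_id 0).const_sub c) (by simp)
      simpa [Function.comp_def] using this
    have := h1.fun_sub h2
    rwa [sub_neg_eq_add, add_comm] at this
  have hlim : Tendsto (fun δ : ℝ => δ⁻¹ • (γ (c + δ) - σ (c - δ))) (𝓝[>] 0) (𝓝 (v + w)) := by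
    have := (hasDerivAt_iff_tendsto_slope.1 hD).mono_left
      (nhdsWithin_mono (0 : ℝ) (fun x (hx : 0 < x) => ne_of_gt hx))
    refine this.congr fun δ => ?_
    simp [slope, hc]
  -- The bound `m < 2` persists near `(γ c, v + w)`. For small `δ` the whole chord, with its
  -- velocity rescaled by `δ⁻¹`, lies in this ball, so its length is at most `δ * m`.
  obtain ⟨r, hr, hball⟩ := Metric.eventually_nhds_iff_ball.1
    ((continuous_tangentNorm α).continuousAt.eventually_lt continuousAt_const hm :
      ∀ᶠ x in 𝓝 ((γ c, v + w) : Pt × Pt), tangentNorm α x.1 x.2 < m)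
  have hs : Tendsto (fun δ : ℝ => σ (c - δ)) (𝓝[>] 0) (𝓝 (γ c)) := by
    have : ContinuousAt (fun δ : ℝ => σ (c - δ)) 0 :=
      ContinuousAt.comp' (by simpa using hσ.continuousAt) (by fun_prop)
    simpa [ContinuousAt, hc] using this.mono_left nhdsWithin_le_nhds
  have hg : Tendsto (fun δ : ℝ => γ (c + δ)) (𝓝[>] 0) (𝓝 (γ c)) := by
    have : ContinuousAt (fun δ : ℝ => γ (c + δ)) 0 :=
      ContinuousAt.comp' (by simpa using hγ.continuousAt) (by fun_prop)
    simpa [ContinuousAt] using this.mono_left nhdsWithin_le_nhds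
  filter_upwards [hlim (Metric.ball_mem_nhds _ hr), hs (Metric.ball_mem_nhds _ hr),
    hg (Metric.ball_mem_nhds _ hr), self_mem_nhdsWithin] with δ h1 h2 h3 hδ
  have hδ : 0 < δ := hδ
  set D := γ (c + δ) - σ (c - δ) with hDdef
  refine ⟨length α (fun t : ℝ => σ (c - δ) + t • D) 0 1, ?_,
    fun t : ℝ => σ (c - δ) + t • D, by fun_prop, by simp, by simp [hDdef], rfl⟩
  have hd : ∀ t : ℝ, deriv (fun t : ℝ => σ (c - δ) + t • D) t = D := fun t => by
    simpa using (((hasDerivAt_id t).smul_const D).const_add (σ (c - δ))).deriv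
  have hle : ∀ t ∈ Set.Icc (0 : ℝ) 1,
      tangentNorm α (σ (c - δ) + t • D) (deriv (fun t : ℝ => σ (c - δ) + t • D) t) ≤ δ * m := by
    intro t ht
    rw [hd, ← smul_inv_smul₀ hδ.ne' D, tangentNorm_smul hδ.le, smul_inv_smul₀ hδ.ne']
    have hmem : σ (c - δ) + t • D ∈ Metric.ball (γ c) r := by
      have := (convex_ball (γ c) r) h2 h3 (sub_nonneg.2 ht.2) ht.1 (by ring)
      convert this using 1
      simp only [hDdef]
      module
    have := hball (σ (c - δ) + t • D, δ⁻¹ • D) (by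
      rw [← ball_prod_same]; exact ⟨hmem, h1⟩)
    exact mul_le_mul_of_nonneg_left this.le hδ.le
  have hcont : Continuous fun t : ℝ =>
      tangentNorm α (σ (c - δ) + t • D) (deriv (fun t : ℝ => σ (c - δ) + t • D) t) := by
    simp only [hd]
    exact continuousOn_univ.1 (continuousOn_tangentNorm (by fun_prop) continuousOn_const)
  calc _ ≤ ∫ _t in (0 : ℝ)..1, δ * m :=
        intervalIntegral.integral_mono_on zero_le_one (hcont.intervalIntegrable _ _)
          (continuous_const.intervalIntegrable _ _) hle
    _ = δ * m := by simp
    _ < 2 * δ := by nlinarith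

/-! ### The geodesic equations and the flow on the unit sphere -/

theorem partialDeriv_metric (α : ℝ) (i j l : Fin 3) (p : Pt) :
    partialDeriv i (fun q => metric α q j l) p = if i = 2 then Matrix.diagonal
      ![-2 * Real.exp (-2 * p 2), 2 * α * Real.exp (2 * α * p 2), 0] j l else 0 := by
  have hexp : ∀ k : ℝ, partialDeriv i (fun q => Real.exp (k * q 2)) p =
      if i = 2 then k * Real.exp (k * p 2) else 0 := fun k => by
    have h : HasFDerivAt (fun q : Pt => Real.exp (k * q 2)) _ p :=
      (((ContinuousLinearMap.proj (R := ℝ) (φ := fun _ : Fin 3 => ℝ) 2).hasFDerivAt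
        (x := p)).const_mul k).exp
    rw [partialDeriv, h.fderiv]
    fin_cases i <;> simp
    ring
  have hconst : ∀ k : ℝ, partialDeriv i (fun _ => k) p = 0 := fun k => by simp [partialDeriv]
  fin_cases j <;> fin_cases l <;> simp [metric, hexp, hconst, -neg_mul]

theorem metric_inv (α : ℝ) (p : Pt) : (metric α p)⁻¹ =
    Matrix.diagonal ![Real.exp (2 * p 2), Real.exp (-(2 * α * p 2)), 1] := by
  refine Matrix.inv_eq_right_inv ?_
  rw [metric, Matrix.diagonal_mul_diagonal, ← Matrix.diagonal_one]
  congr 1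
  ext i
  fin_cases i <;> simp [← Real.exp_add]

/-- The vector field on the Lie algebra of which the developments are integral curves. -/
def field (α : ℝ) (u : Pt) : Pt := ![u 0 * u 2, -α * u 1 * u 2, -u 0 ^ 2 + α * u 1 ^ 2]

theorem development_eq (α : ℝ) (γ : ℝ → Pt) (t : ℝ) :
    development α γ t =
      ![Real.exp (-γ t 2) * deriv γ t 0, Real.exp (α * γ t 2) * deriv γ t 1, deriv γ t 2] := by
  have h : HasFDerivAt (mul α (inv α (γ t))) (ContinuousLinearMap.pi
      ![Real.exp (-γ t 2) • ContinuousLinearMap.proj (R := ℝ) (φ := fun _ : Fin 3 => ℝ) 0,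
        Real.exp (α * γ t 2) • ContinuousLinearMap.proj (R := ℝ) (φ := fun _ : Fin 3 => ℝ) 1,
        ContinuousLinearMap.proj (R := ℝ) (φ := fun _ : Fin 3 => ℝ) 2]) (γ t) := by
    have hp : ∀ k, HasFDerivAt (fun q : Pt => q k)
        (ContinuousLinearMap.proj (R := ℝ) (φ := fun _ : Fin 3 => ℝ) k) (γ t) := fun k =>
      (ContinuousLinearMap.proj (R := ℝ) (φ := fun _ : Fin 3 => ℝ) k).hasFDerivAt
    refine hasFDerivAt_pi.2 fun k => ?_
    fin_cases k
    · simpa [mul, inv] using ((hp 0).mul_const (Real.exp (-γ t 2))).add_const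
        (-(γ t 0 * Real.exp (-γ t 2)))
    · simpa [mul, inv] using ((hp 1).mul_const (Real.exp (α * γ t 2))).add_const
        (-(γ t 1 * Real.exp (α * γ t 2)))
    · simpa [mul, inv] using (hp 2).add_const (-γ t 2)
  rw [development, h.fderiv]
  ext k
  fin_cases k <;> simp

/-- A `C²` curve of unit speed on the open set `I` solving the geodesic equation there. -/
def IsGeodesicOn (α : ℝ) (γ : ℝ → Pt) (I : Set ℝ) : Prop :=
  IsOpen I ∧ ContDiffOn ℝ 2 γ I ∧
    ∀ t ∈ I, tangentNorm α (γ t) (deriv γ t) = 1 ∧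
      ∀ k, deriv (deriv γ) t k
        + ∑ i, ∑ j, christoffel α k i j (γ t) * deriv γ t i * deriv γ t j = 0

namespace IsGeodesicOn

variable {γ : ℝ → Pt} {I : Set ℝ} {t : ℝ}

theorem contDiffOn_deriv (h : IsGeodesicOn α γ I) : ContDiffOn ℝ 1 (deriv γ) I :=
  ((contDiffOn_succ_iff_deriv_of_isOpen (n := 1) h.1).1 (by
    have := h.2.1; rwa [show ((1 : WithTop ℕ∞) + 1) = 2 from one_add_one_eq_two])).2.2

theorem hasDerivAt (h : IsGeodesicOn α γ I) (ht : t ∈ I) : HasDerivAt γ (deriv γ t) t :=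
  ((h.2.1.differentiableOn two_ne_zero).differentiableAt (h.1.mem_nhds ht)).hasDerivAt

theorem hasDerivAt_deriv (h : IsGeodesicOn α γ I) (ht : t ∈ I) :
    HasDerivAt (deriv γ) (deriv (deriv γ) t) t :=
  ((h.contDiffOn_deriv.differentiableOn one_ne_zero).differentiableAt (h.1.mem_nhds ht)).hasDerivAt

theorem equations (h : IsGeodesicOn α γ I) (ht : t ∈ I) :
    deriv (deriv γ) t = ![2 * deriv γ t 0 * deriv γ t 2, -2 * α * deriv γ t 1 * deriv γ t 2,
      -Real.exp (-2 * γ t 2) * deriv γ t 0 ^ 2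
        + α * Real.exp (2 * α * γ t 2) * deriv γ t 1 ^ 2] := by
  have he := (h.2.2 t ht).2
  have e0 := he 0
  have e1 := he 1
  have e2 := he 2
  have c0 : Real.exp (2 * γ t 2) * Real.exp (-2 * γ t 2) = 1 := by
    rw [← Real.exp_add]; simp
  have c1 : Real.exp (-(2 * α * γ t 2)) * Real.exp (2 * α * γ t 2) = 1 := by
    rw [← Real.exp_add]; simp
  simp only [christoffel, partialDeriv_metric, metric_inv, Fin.sum_univ_three,
    Matrix.diagonal_apply] at e0 e1 e2
  simp [-neg_mul] at e0 e1 e2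
  ext k
  fin_cases k
  · simp
    linear_combination e0 + 2 * deriv γ t 0 * deriv γ t 2 * c0
  · simp
    linear_combination e1 - 2 * α * deriv γ t 1 * deriv γ t 2 * c1
  · simp
    simp at e2
    linear_combination e2

/-- The development of a geodesic is a flowline. -/
theorem hasDerivAt_development (h : IsGeodesicOn α γ I) (ht : t ∈ I) :
    HasDerivAt (development α γ) (field α (development α γ t)) t := by
  have hd := hasDerivAt_pi.1 (h.hasDerivAt ht)
  have hdd := hasDerivAt_pi.1 (h.hasDerivAt_deriv ht)
  rw [h.equations ht] at hdd
  have hdev : development α γ = fun t =>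
      ![Real.exp (-γ t 2) * deriv γ t 0, Real.exp (α * γ t 2) * deriv γ t 1, deriv γ t 2] :=
    funext (development_eq α γ)
  rw [hdev]
  refine hasDerivAt_pi.2 fun k => ?_
  fin_cases k
  · refine ((hd 2).fun_neg.exp.mul (hdd 0)).congr_deriv ?_
    simp [field]
    ring
  · refine (((hd 2).const_mul α).exp.mul (hdd 1)).congr_deriv ?_
    simp [field]
    ring
  · refine (hdd 2).congr_deriv ?_
    simp only [field, Matrix.cons_val, Fin.reduceFinMk, mul_pow, ← Real.exp_nat_mul]
    ring_nf

theorem development_sq (h : IsGeodesicOn α γ I) (ht : t ∈ I) :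
    development α γ t 0 ^ 2 + development α γ t 1 ^ 2 + development α γ t 2 ^ 2 = 1 := by
  have h1 := (h.2.2 t ht).1
  rw [tangentNorm_eq, Real.sqrt_eq_one] at h1
  rw [development_eq, ← h1]
  simp only [Matrix.cons_val, mul_pow, ← Real.exp_nat_mul]
  ring_nf

theorem length_eq (h : IsGeodesicOn α γ I) {a b : ℝ} (hab : a ≤ b) (hI : Set.Icc a b ⊆ I) :
    length α γ a b = b - a := by
  rw [length, intervalIntegral.integral_congr (g := fun _ => 1)]
  · simp
  · intro t ht
    rw [Set.uIcc_of_le hab] at ht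
    exact (h.2.2 t (hI ht)).1

theorem joins (h : IsGeodesicOn α γ I) {a b : ℝ} (hab : a ≤ b) (hI : Set.Icc a b ⊆ I) :
    Joins α (γ a) (γ b) (b - a) := by
  rw [← h.length_eq hab hI]
  exact joins_of_contDiffOn h.1 (h.2.1.of_le one_le_two) hab hI

end IsGeodesicOn

theorem isGeodesicSegment_iff {γ : ℝ → Pt} {a b : ℝ} :
    IsGeodesicSegment α γ a b ↔ ∃ I, Set.Icc a b ⊆ I ∧ IsGeodesicOn α γ I := by
  unfold IsGeodesicSegment IsGeodesicOn
  exact exists_congr fun I => ⟨fun ⟨h1, h2, h3⟩ => ⟨h2, h1, h3⟩, fun ⟨h1, h2, h3⟩ => ⟨h2, h1, h3⟩⟩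

theorem contDiff_field (α : ℝ) : ContDiff ℝ 1 (field α) := by
  refine contDiff_pi.2 fun k => ?_
  fin_cases k <;> simp only [field] <;> simp <;> fun_prop

/-- The field is quadratic, hence only locally Lipschitz; the unit sphere lies in the compact
sup-norm ball, where one constant serves. -/
theorem eqOn_of_flowlines {u v : ℝ → Pt} {a b : ℝ}
    (hu : ∀ t ∈ Set.Icc a b, HasDerivAt u (field α (u t)) t)
    (hv : ∀ t ∈ Set.Icc a b, HasDerivAt v (field α (v t)) t)
    (hu1 : ∀ t ∈ Set.Icc a b, u t 0 ^ 2 + u t 1 ^ 2 + u t 2 ^ 2 = 1)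
    (hv1 : ∀ t ∈ Set.Icc a b, v t 0 ^ 2 + v t 1 ^ 2 + v t 2 ^ 2 = 1)
    (h : u a = v a) : Set.EqOn u v (Set.Icc a b) := by
  have hK : ∃ K, LipschitzOnWith K (field α) (Metric.closedBall 0 1) :=
    LocallyLipschitzOn.exists_lipschitzOnWith_of_compact (isCompact_closedBall (0 : Pt) 1)
      (contDiff_field α).locallyLipschitz.locallyLipschitzOn
  obtain ⟨K, hK⟩ := hK
  have hball : ∀ w : Pt, w 0 ^ 2 + w 1 ^ 2 + w 2 ^ 2 = 1 → w ∈ Metric.closedBall (0 : Pt) 1 := by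
    intro w hw
    rw [mem_closedBall_zero_iff, pi_norm_le_iff_of_nonneg zero_le_one]
    intro i
    rw [Real.norm_eq_abs, ← sq_le_one_iff_abs_le_one]
    rw [← hw, ← Fin.sum_univ_three (fun i => w i ^ 2)]
    exact Finset.single_le_sum (fun j _ => sq_nonneg (w j)) (Finset.mem_univ i)
  exact ODE_solution_unique_of_mem_Icc_right (v := fun _ => field α) (K := K)
    (s := fun _ => Metric.closedBall 0 1)
    (fun _ _ => hK) (fun t ht => (hu t ht).continuousAt.continuousWithinAt)
    (fun t ht => (hu t (Set.Ico_subset_Icc_self ht)).hasDerivWithinAt)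
    (fun t ht => hball _ (hu1 t (Set.Ico_subset_Icc_self ht)))
    (fun t ht => (hv t ht).continuousAt.continuousWithinAt)
    (fun t ht => (hv t (Set.Ico_subset_Icc_self ht)).hasDerivWithinAt)
    (fun t ht => hball _ (hv1 t (Set.Ico_subset_Icc_self ht))) h

/-! ### Lower bounds for return times -/

/-- **Wirtinger's inequality** for periodic functions of mean zero. -/
theorem wirtinger {w w' : ℝ → ℝ} {T : ℝ} (hT : 0 < T)
    (hw : ∀ t ∈ Set.Icc 0 T, HasDerivAt w (w' t) t) (hw' : ContinuousOn w' (Set.Icc 0 T))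
    (hper : w 0 = w T) (hmean : ∫ t in 0..T, w t = 0) :
    (2 * Real.pi / T) ^ 2 * ∫ t in 0..T, w t ^ 2 ≤ ∫ t in 0..T, w' t ^ 2 := by
  have hL2 : ∀ f : ℝ → ℝ, ContinuousOn f (Set.Icc 0 T) → MeasureTheory.MemLp
      (fun t => (f t : ℂ)) 2 (MeasureTheory.volume.restrict (Set.Ioc 0 T)) := fun f hf => by
    have hc : ContinuousOn (fun t => (f t : ℂ)) (Set.Icc 0 T) :=
      Complex.continuous_ofReal.comp_continuousOn hf
    obtain ⟨C, hC⟩ := isCompact_Icc.exists_bound_of_continuousOn hc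
    refine MeasureTheory.MemLp.of_bound ((hc.mono Set.Ioc_subset_Icc_self).aestronglyMeasurable
      measurableSet_Ioc) C ?_
    filter_upwards [MeasureTheory.ae_restrict_mem measurableSet_Ioc] with t ht
    exact hC t (Set.Ioc_subset_Icc_self ht)
  have hwc : ContinuousOn w (Set.Icc 0 T) := fun t ht =>
    (hw t ht).continuousAt.continuousWithinAt
  have s1 := hasSum_sq_fourierCoeffOn hT (hL2 w hwc)
  have s2 := hasSum_sq_fourierCoeffOn hT (hL2 w' hw')
  -- Parseval reduces the claim to single coefficients. Mean zero settles `n = 0`; for `n ≠ 0`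
  -- periodicity removes the boundary term and `|n| ≥ 1` gives the estimate.
  have hcoef : ∀ n : ℤ, (2 * Real.pi / T) ^ 2 * ‖fourierCoeffOn hT (fun t => (w t : ℂ)) n‖ ^ 2 ≤
      ‖fourierCoeffOn hT (fun t => (w' t : ℂ)) n‖ ^ 2 := by
    intro n
    rcases eq_or_ne n 0 with rfl | hn
    · have : fourierCoeffOn hT (fun t => (w t : ℂ)) 0 = 0 := by
        rw [fourierCoeffOn_eq_integral]
        simp [intervalIntegral.integral_ofReal, hmean]
      rw [this]
      simp
    · have := fourierCoeffOn_of_hasDerivAt hT (f := fun t => (w t : ℂ))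
        (f' := fun t => (w' t : ℂ)) hn
        (fun t ht => (hw t (by rwa [Set.uIcc_of_le hT.le] at ht)).ofReal_comp)
        (ContinuousOn.intervalIntegrable (by
          rw [Set.uIcc_of_le hT.le]
          exact Complex.continuous_ofReal.comp_continuousOn hw'))
      rw [this, hper]
      simp only [sub_self, mul_zero, zero_sub, sub_zero, Complex.ofReal_zero]
      rw [norm_mul, norm_neg, norm_mul, norm_div, mul_pow, mul_pow]
      simp only [norm_one, norm_mul, norm_neg, Complex.norm_I, Complex.norm_real,
        Complex.norm_ofNat, Complex.norm_intCast, mul_one, Real.norm_eq_abs, abs_of_pos Real.pi_pos,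
        abs_of_pos hT]
      have h1 : (1 : ℝ) ≤ |(n : ℝ)| := by exact_mod_cast Int.one_le_abs hn
      have : (2 * Real.pi / T) ^ 2 * ((1 / (2 * Real.pi * |(n : ℝ)|)) ^ 2 * (T ^ 2 *
          ‖fourierCoeffOn hT (fun t => (w' t : ℂ)) n‖ ^ 2)) =
          ‖fourierCoeffOn hT (fun t => (w' t : ℂ)) n‖ ^ 2 / |(n : ℝ)| ^ 2 := by
        have := Real.pi_pos
        have : |(n : ℝ)| ≠ 0 := by positivity
        field_simp
      rw [this]
      exact div_le_self (sq_nonneg _) (one_le_pow₀ h1)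
  have := hasSum_le hcoef (s1.mul_left _) s2
  simp only [Complex.norm_real, Real.norm_eq_abs, sq_abs, sub_zero, smul_eq_mul] at this
  rw [mul_left_comm] at this
  exact le_of_mul_le_mul_left this (inv_pos.2 hT)

namespace IsGeodesicOn

variable {γ : ℝ → Pt} {I : Set ℝ}

theorem hasDerivAt_height (h : IsGeodesicOn α γ I) {t : ℝ} (ht : t ∈ I) :
    HasDerivAt (fun t => γ t 2) (development α γ t 2) t := by
  have := hasDerivAt_pi.1 (h.hasDerivAt ht) 2
  rwa [development_eq]

theorem development_zero_eq (h : IsGeodesicOn α γ I) {a b : ℝ} (hI : Set.Icc a b ⊆ I)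
    {t : ℝ} (ht : t ∈ Set.Icc a b) :
    development α γ t 0 = development α γ a 0 * Real.exp (γ t 2 - γ a 2) := by
  have hd : ∀ s ∈ Set.Icc a b,
      HasDerivAt (fun s => development α γ s 0 * Real.exp (-γ s 2)) 0 s := fun s hs => by
    refine ((hasDerivAt_pi.1 (h.hasDerivAt_development (hI hs)) 0).mul
      (h.hasDerivAt_height (hI hs)).fun_neg.exp).congr_deriv ?_
    simp [field]
    ring
  have := constant_of_has_deriv_right_zero
    (fun s hs => (hd s hs).continuousAt.continuousWithinAt)
    (fun s hs => (hd s (Set.Ico_subset_Icc_self hs)).hasDerivWithinAt) t ht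
  rw [sub_eq_add_neg, Real.exp_add, mul_left_comm, ← this, mul_left_comm, ← Real.exp_add]
  simp

theorem development_one_eq (h : IsGeodesicOn α γ I) {a b : ℝ} (hI : Set.Icc a b ⊆ I)
    {t : ℝ} (ht : t ∈ Set.Icc a b) :
    development α γ t 1 = development α γ a 1 * Real.exp (-α * (γ t 2 - γ a 2)) := by
  have hd : ∀ s ∈ Set.Icc a b,
      HasDerivAt (fun s => development α γ s 1 * Real.exp (α * γ s 2)) 0 s := fun s hs => by
    refine ((hasDerivAt_pi.1 (h.hasDerivAt_development (hI hs)) 1).mul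
      ((h.hasDerivAt_height (hI hs)).const_mul α).exp).congr_deriv ?_
    simp [field]
    ring
  have := constant_of_has_deriv_right_zero
    (fun s hs => (hd s hs).continuousAt.continuousWithinAt)
    (fun s hs => (hd s (Set.Ico_subset_Icc_self hs)).hasDerivWithinAt) t ht
  rw [show -α * (γ t 2 - γ a 2) = -(α * γ t 2) + α * γ a 2 by ring, Real.exp_add, mul_left_comm,
    ← this, mul_left_comm, ← Real.exp_add]
  simp

/-- A lower bound for the return times of a nonstationary flowline on which the second derivative
of the potential is at most `M`. -/
theorem le_of_return (h : IsGeodesicOn α γ I) {τ M : ℝ} (hτ : 0 < τ) (hI : Set.Icc 0 τ ⊆ I)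
    (hret : development α γ τ = development α γ 0) (h0 : development α γ 0 0 ≠ 0)
    (h2 : development α γ 0 2 ≠ 0)
    (hM : ∀ t ∈ Set.Icc 0 τ,
      2 * development α γ t 0 ^ 2 + 2 * α ^ 2 * development α γ t 1 ^ 2 ≤ M) :
    (2 * Real.pi / τ) ^ 2 ≤ M := by
  set u := development α γ with hu
  have hd : ∀ t ∈ Set.Icc 0 τ, ∀ k, HasDerivAt (fun t => u t k) (field α (u t) k) t := fun t ht =>
    hasDerivAt_pi.1 (h.hasDerivAt_development (hI ht))
  have hc : ∀ k, ContinuousOn (fun t => u t k) (Set.Icc 0 τ) := fun k t ht =>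
    (hd t ht k).continuousAt.continuousWithinAt
  have hc0 := hc 0
  have hc1 := hc 1
  have hc2 := hc 2
  have hw' : ContinuousOn (fun t => field α (u t) 2) (Set.Icc 0 τ) := by
    simp only [field, Matrix.cons_val]
    fun_prop
  have hint : ∀ f : ℝ → ℝ, ContinuousOn f (Set.Icc 0 τ) →
      IntervalIntegrable f MeasureTheory.volume 0 τ := fun f hf =>
    ContinuousOn.intervalIntegrable (by rwa [Set.uIcc_of_le hτ.le])
  -- `u 2` is the derivative of the height, and the height returns because `u 0` is a nonzero
  -- multiple of its exponential.
  have hmean : ∫ t in 0..τ, u t 2 = 0 := by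
    rw [intervalIntegral.integral_eq_sub_of_hasDerivAt (f := fun t => γ t 2)
      (fun t ht => h.hasDerivAt_height (hI (by rwa [Set.uIcc_of_le hτ.le] at ht))) (hint _ hc2)]
    have := h.development_zero_eq hI (Set.right_mem_Icc.2 hτ.le)
    rw [← hu, hret, eq_comm, mul_eq_left₀ h0, Real.exp_eq_one_iff] at this
    exact this
  have hW := wirtinger hτ (fun t ht => hd t ht 2) hw' (by rw [hret]) hmean
  set q : ℝ → ℝ := fun t => 2 * u t 0 ^ 2 + 2 * α ^ 2 * u t 1 ^ 2 with hq
  have hqc : ContinuousOn q (Set.Icc 0 τ) := by simp only [hq]; fun_prop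
  -- With `w = u 2` and `w'' = -q w`, the integrand is the derivative of the periodic function `w *
  -- w'`.
  have hparts : ∫ t in 0..τ, (field α (u t) 2 ^ 2 - q t * u t 2 ^ 2) = 0 := by
    rw [intervalIntegral.integral_eq_sub_of_hasDerivAt
      (f := fun t => u t 2 * (-u t 0 ^ 2 + α * u t 1 ^ 2)) (fun t ht => ?_)
      (hint _ (by fun_prop))]
    · simp only [hret, sub_self]
    · rw [Set.uIcc_of_le hτ.le] at ht
      refine ((hd t ht 2).mul (((hd t ht 0).fun_pow 2).fun_neg.fun_add
        (((hd t ht 1).fun_pow 2).const_mul α))).congr_deriv ?_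
      simp [field, hq]
      ring
  rw [intervalIntegral.integral_sub (hint _ (by fun_prop)) (hint _ (by fun_prop)),
    sub_eq_zero] at hparts
  have hle : ∫ t in 0..τ, q t * u t 2 ^ 2 ≤ M * ∫ t in 0..τ, u t 2 ^ 2 := by
    rw [← intervalIntegral.integral_const_mul]
    exact intervalIntegral.integral_mono_on hτ.le (hint _ (by fun_prop)) (hint _ (by fun_prop))
      fun t ht => mul_le_mul_of_nonneg_right (hM t ht) (sq_nonneg _)
  have hpos : 0 < ∫ t in 0..τ, u t 2 ^ 2 :=
    intervalIntegral.integral_pos hτ (by fun_prop) (fun _ _ => sq_nonneg _)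
      ⟨0, Set.left_mem_Icc.2 hτ.le, by positivity⟩
  exact le_of_mul_le_mul_right (hW.trans (hparts.le.trans hle)) hpos

end IsGeodesicOn

/-- An upper bound, on the flowline of `unitVec α β`, for the second derivative of the potential.
It tends to `2 α` as `β` tends to `1`. -/
def curvatureBound (α β : ℝ) : ℝ :=
  2 * α ^ 2 + 2 * (1 - α) * α * Real.exp (2 * √((1 / β ^ 2 - 1) * (1 + α) / (2 * α)))

theorem tendsto_curvatureBound (α : ℝ) :
    Tendsto (curvatureBound α) (𝓝[<] 1) (𝓝 (2 * α)) := by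
  have : ContinuousAt (curvatureBound α) 1 := by
    unfold curvatureBound
    have : ((1 : ℝ) ^ 2) ≠ 0 := by norm_num
    fun_prop (disch := assumption)
  have h := this.mono_left (nhdsWithin_le_nhds (s := Set.Iio 1))
  rwa [show curvatureBound α 1 = 2 * α by simp [curvatureBound]; ring] at h

/-- Since `x² + y² ≤ 1`, the potential term is at most `2α² + 2(1 - α²)x²`, and `x²` is a multiple
of `exp (2z)`; so everything rests on bounding the height `z` from above. -/
theorem unitVec_le_returnTime (hα₀ : 0 < α) (hα₁ : α ≤ 1) {β : ℝ} (hβ₀ : 0 < β) (hβ₁ : β < 1) :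
    ENNReal.ofReal (2 * Real.pi / √(curvatureBound α β)) ≤ returnTime α (unitVec α β) := by
  refine le_iInf₂ fun τ ⟨hτ, γ, hγ, hγ0, hd0, hdτ⟩ => ENNReal.ofReal_le_ofReal ?_
  obtain ⟨I, hI, h⟩ := isGeodesicSegment_iff.1 hγ
  have hc : 0 < √(α / (1 + α)) := Real.sqrt_pos.2 (by positivity)
  have hβ2 : β ^ 2 < 1 := by nlinarith
  have hM := h.le_of_return (M := curvatureBound α β) hτ hI (hdτ.trans hd0.symm)
    (by rw [hd0]; simp [unitVec]; exact ⟨hβ₀.ne', hc.ne'⟩)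
    (by rw [hd0]; simp only [unitVec, Matrix.cons_val]; exact (Real.sqrt_pos.2 (by linarith)).ne')
    (fun t ht => ?_)
  · have hM0 : 0 < curvatureBound α β := lt_of_lt_of_le (by have := Real.pi_pos; positivity) hM
    rw [div_le_iff₀ (Real.sqrt_pos.2 hM0), ← div_le_iff₀' hτ]
    exact Real.le_sqrt_of_sq_le hM
  · have e0 := h.development_zero_eq hI ht
    have e1 := h.development_one_eq hI ht
    have hsq := h.development_sq (hI ht)
    set z := γ t 2
    rw [hd0, hγ0] at e0 e1
    simp only [unitVec, Matrix.cons_val, Pi.zero_apply, sub_zero] at e0 e1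
    set x := development α γ t 0
    set y := development α γ t 1
    have x2 : x ^ 2 = β ^ 2 * (α / (1 + α)) * Real.exp (2 * z) := by
      rw [e0, mul_pow, mul_pow, Real.sq_sqrt (by positivity), ← Real.exp_nat_mul]
      norm_num
    have y2 : y ^ 2 = β ^ 2 / (1 + α) * Real.exp (-(2 * α * z)) := by
      rw [e1, mul_pow, div_pow, Real.sq_sqrt (by positivity), ← Real.exp_nat_mul]
      ring_nf
    have hz : z ≤ √((1 / β ^ 2 - 1) * (1 + α) / (2 * α)) := by
      rcases le_or_gt z 0 with hz | hz
      · exact hz.trans (Real.sqrt_nonneg _)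
      · refine Real.le_sqrt_of_sq_le ?_
        have b1 := Real.quadratic_le_exp_of_nonneg (x := 2 * z) (by linarith)
        have b2 := Real.add_one_le_exp (-(2 * α * z))
        have hs : β ^ 2 * (α * Real.exp (2 * z) + Real.exp (-(2 * α * z))) ≤ 1 + α := by
          have : x ^ 2 + y ^ 2 ≤ 1 := by nlinarith [sq_nonneg (development α γ t 2)]
          have hxy : x ^ 2 + y ^ 2 =
              β ^ 2 * (α * Real.exp (2 * z) + Real.exp (-(2 * α * z))) / (1 + α) := by
            rw [x2, y2]
            ring
          rwa [hxy, div_le_one (by positivity)] at this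
        -- From `exp (2z) ≥ 1 + 2z + 2z²` and `exp (-2αz) ≥ 1 - 2αz`: the linear terms cancel in the
        -- weighted sum.
        have hs2 : β ^ 2 * (1 + α + 2 * α * z ^ 2) ≤ 1 + α := by
          refine le_trans (mul_le_mul_of_nonneg_left ?_ (sq_nonneg β)) hs
          nlinarith
        rw [le_div_iff₀ (by positivity), ← sub_nonneg]
        have : (1 / β ^ 2 - 1) * (1 + α) - z ^ 2 * (2 * α) =
            (1 + α - β ^ 2 * (1 + α + 2 * α * z ^ 2)) / β ^ 2 := by
          field_simp
          ring
        rw [this]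
        exact div_nonneg (by linarith) (sq_nonneg _)
    have hx : (1 - α ^ 2) * x ^ 2 ≤ (1 - α) * α *
        Real.exp (2 * √((1 / β ^ 2 - 1) * (1 + α) / (2 * α))) := by
      have : (1 - α ^ 2) * x ^ 2 = β ^ 2 * ((1 - α) * α * Real.exp (2 * z)) := by
        rw [x2]
        field_simp
        ring
      rw [this]
      have h1 : 0 ≤ (1 - α) * α := mul_nonneg (by linarith) hα₀.le
      refine (mul_le_of_le_one_left (by positivity) hβ2.le).trans ?_
      gcongr
    unfold curvatureBound
    nlinarith [mul_nonneg (sq_nonneg α) (sq_nonneg (development α γ t 2))]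

theorem le_liminf_returnTime (hα₀ : 0 < α) (hα₁ : α ≤ 1) :
    ENNReal.ofReal (2 * Real.pi / √(2 * α)) ≤
      liminf (fun β : ℝ => returnTime α (unitVec α β)) (𝓝[<] 1) := by
  have hs : √(2 * α) ≠ 0 := (Real.sqrt_pos.2 (by linarith)).ne'
  have ht : Tendsto (fun β => ENNReal.ofReal (2 * Real.pi / √(curvatureBound α β))) (𝓝[<] 1)
      (𝓝 (ENNReal.ofReal (2 * Real.pi / √(2 * α)))) :=
    ENNReal.tendsto_ofReal (tendsto_const_nhds.div
      ((Real.continuous_sqrt.tendsto _).comp (tendsto_curvatureBound α)) hs)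
  rw [← ht.liminf_eq]
  refine liminf_le_liminf ?_
  filter_upwards [Ioo_mem_nhdsLT zero_lt_one] with β hβ
  exact unitVec_le_returnTime hα₀ hα₁ hβ.1 hβ.2

/-! ### Non-straight geodesics: the mirror arc -/

/-- The curve `γ` run backwards and reflected by the half-turn `(x, y, z) ↦ (A - x, B - y, z)`. -/
def mirror (γ : ℝ → Pt) (A B s t : ℝ) : Pt :=
  ![A - γ (s - t) 0, B - γ (s - t) 1, γ (s - t) 2]

namespace IsGeodesicOn

variable {γ : ℝ → Pt} {I : Set ℝ} {A B s t : ℝ}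

theorem hasDerivAt_mirror (h : IsGeodesicOn α γ I) (ht : s - t ∈ I) :
    HasDerivAt (mirror γ A B s)
      ![deriv γ (s - t) 0, deriv γ (s - t) 1, -deriv γ (s - t) 2] t := by
  have hd : ∀ k, HasDerivAt (fun t => γ (s - t) k) (-deriv γ (s - t) k) t := fun k => by
    have := (hasDerivAt_pi.1 (h.hasDerivAt ht) k).comp t ((hasDerivAt_id t).const_sub s)
    simpa [Function.comp_def] using this
  refine hasDerivAt_pi.2 fun k => ?_
  fin_cases k
  · simpa [mirror] using (hd 0).const_sub A
  · simpa [mirror] using (hd 1).const_sub B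
  · simpa [mirror] using hd 2

theorem joins_mirror (h : IsGeodesicOn α γ I) {c d : ℝ} (hcd : c ≤ d)
    (hI : ∀ t ∈ Set.Icc c d, s - t ∈ I) :
    Joins α (mirror γ A B s c) (mirror γ A B s d) (d - c) := by
  set J := (fun t => s - t) ⁻¹' I with hJ
  have hJo : IsOpen J := h.1.preimage (by fun_prop)
  have hcomp : ContDiffOn ℝ 1 (fun t => γ (s - t)) J :=
    (h.2.1.of_le one_le_two).comp (by fun_prop) fun _ ht => ht
  have hC : ContDiffOn ℝ 1 (mirror γ A B s) J := by
    have hk := contDiffOn_pi.1 hcomp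
    refine contDiffOn_pi.2 fun k => ?_
    fin_cases k
    · simpa [mirror] using contDiffOn_const.sub (hk 0)
    · simpa [mirror] using contDiffOn_const.sub (hk 1)
    · simpa [mirror] using hk 2
  have hlen : length α (mirror γ A B s) c d = d - c := by
    rw [length, intervalIntegral.integral_congr (g := fun _ => 1)]
    · simp
    · intro t ht
      rw [Set.uIcc_of_le hcd] at ht
      have h1 := (h.2.2 (s - t) (hI t ht)).1
      rw [tangentNorm_eq] at h1
      simp only [(h.hasDerivAt_mirror (hI t ht)).deriv, tangentNorm_eq]
      simpa [mirror] using h1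
  rw [← hlen]
  exact joins_of_contDiffOn hJo hC hcd hI

/-- A geodesic that runs past a full period of its height, starting at a point where the height
is not stationary, is not a minimizer. -/
theorem not_isLengthMinimizer_of_height (h : IsGeodesicOn α γ I) {a b c d : ℝ} (hac : a ≤ c)
    (hcd : c < d) (hdb : d < b) (hI : Set.Icc a b ⊆ I)
    (hz : γ d 2 = γ c 2) (hdev : development α γ d = development α γ c)
    (hu : development α γ c 2 ≠ 0) : ¬ IsLengthMinimizer α γ a b := by
  intro hmin
  have hcI : c ∈ I := hI ⟨hac, by linarith⟩
  have hdI : d ∈ I := hI ⟨by linarith, hdb.le⟩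
  set σ := mirror γ (γ c 0 + γ d 0) (γ c 1 + γ d 1) (c + d) with hσ
  have hsd : c + d - d = c := by ring
  have hσc : σ c = γ c := by
    ext k
    fin_cases k <;> simp [hσ, mirror, hz]
  have hσd : σ d = γ d := by
    ext k
    fin_cases k <;> simp [hσ, mirror, hz]
  have hd1 := h.hasDerivAt_mirror (A := γ c 0 + γ d 0) (B := γ c 1 + γ d 1) (s := c + d) (t := d)
    (by rwa [hsd])
  rw [hsd, ← hσ] at hd1
  have hderiv : deriv γ d = deriv γ c := by
    simp only [development_eq, hz] at hdev
    have e0 := congrFun hdev 0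
    have e1 := congrFun hdev 1
    have e2 := congrFun hdev 2
    simp at e0 e1 e2
    ext k
    fin_cases k
    exacts [e0, e1, e2]
  -- The third components cancel, so the squared norm of the sum is `4 * (1 - (deriv γ c 2)²)`.
  have hlt : tangentNorm α (γ d) (![deriv γ c 0, deriv γ c 1, -deriv γ c 2] + deriv γ d) < 2 := by
    have h1 := (h.2.2 c hcI).1
    rw [tangentNorm_eq, Real.sqrt_eq_one] at h1
    rw [tangentNorm_eq, Real.sqrt_lt' two_pos, hderiv, hz]
    rw [development_eq] at hu
    have : 0 < deriv γ c 2 ^ 2 := by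
      have : deriv γ c 2 ≠ 0 := by simpa using hu
      positivity
    simp only [Pi.add_apply, Matrix.cons_val]
    nlinarith
  have hcorner := exists_joins_of_corner hd1 (h.hasDerivAt hdI) hσd hlt
  obtain ⟨δ, ⟨ℓ, hℓ, hj⟩, hδ⟩ :=
    (hcorner.and (Ioo_mem_nhdsGT (lt_min (sub_pos.2 hcd) (sub_pos.2 hdb)))).exists
  have hδ1 := hδ.2.trans_le (min_le_left _ _)
  have hδ2 := hδ.2.trans_le (min_le_right _ _)
  have hδ0 := hδ.1
  have j1 := h.joins hac (fun t ht => hI ⟨ht.1, by linarith [ht.2]⟩)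
  have j2 := h.joins_mirror (A := γ c 0 + γ d 0) (B := γ c 1 + γ d 1) (s := c + d) (c := c)
    (d := d - δ) (by linarith) (fun t ht => hI ⟨by linarith [ht.2], by linarith [ht.1]⟩)
  have j3 := h.joins (a := d + δ) (b := b) (by linarith)
    (fun t ht => hI ⟨by linarith [ht.1], ht.2⟩)
  rw [← hσ, hσc] at j2
  have := hmin.length_le (by linarith) (((j1.trans j2).trans hj).trans j3)
  rw [h.length_eq (by linarith) hI] at this
  linarith

/-- If `u 2` vanishes on an interval, so does its derivative, whence `(u 0)² = α (u 1)²`; the unit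
sphere then fixes both squares. -/
theorem isStraight_of_height (h : IsGeodesicOn α γ I) (hα₀ : 0 < α) {a d : ℝ} (had : a < d)
    (hI : Set.Icc a d ⊆ I) (hz : ∀ t ∈ Set.Icc a d, development α γ t 2 = 0) :
    IsStraight α (development α γ a) := by
  have haI : a ∈ Set.Icc a d := Set.left_mem_Icc.2 had.le
  have h1 : field α (development α γ a) 2 = 0 :=
    UniqueDiffWithinAt.eq_deriv (Set.Icc a d) (uniqueDiffOn_Icc had a haI)
      (hasDerivAt_pi.1 (h.hasDerivAt_development (hI haI)) 2).hasDerivWithinAt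
      ((hasDerivWithinAt_const a _ (0 : ℝ)).congr hz (hz a haI))
  have h2 := h.development_sq (hI haI)
  have h3 := hz a haI
  simp only [field, Matrix.cons_val] at h1
  set u := development α γ a
  have hy : u 1 ^ 2 = 1 / (1 + α) := by
    rw [eq_div_iff (by positivity)]
    rw [h3] at h2
    linarith
  have hx : u 0 ^ 2 = α / (1 + α) := by
    rw [div_eq_mul_one_div, ← hy]
    linarith
  refine ⟨?_, ?_, h3⟩
  · simp [unitVec, ← Real.sqrt_sq_eq_abs, hx]
  · simp [unitVec, ← Real.sqrt_sq_eq_abs, hy]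

/-- A geodesic that runs past a return time of its flowline is not a minimizer, unless it is
a straight line or lies in a plane `x = const`. -/
theorem not_isLengthMinimizer_of_return (h : IsGeodesicOn α γ I) (hα₀ : 0 < α) {a b τ : ℝ}
    (hτ : 0 < τ) (hτb : τ < b - a) (hI : Set.Icc a b ⊆ I)
    (hret : development α γ (a + τ) = development α γ a)
    (h0 : development α γ a 0 ≠ 0) (hs : ¬ IsStraight α (development α γ a)) :
    ¬ IsLengthMinimizer α γ a b := by
  -- Stopping midway to `b - τ` keeps `c + τ < b` for every `c ≤ d`, which leaves room beyond the
  -- corner.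
  set d := (a + (b - τ)) / 2 with hd
  have had : a < d := by linarith
  have hdb : d + τ < b := by linarith
  have hper : Set.EqOn (fun t => development α γ (t + τ)) (development α γ) (Set.Icc a d) :=
    eqOn_of_flowlines
      (fun t ht => by
        simpa [Function.comp_def] using (h.hasDerivAt_development (t := t + τ)
          (hI ⟨by linarith [ht.1], by linarith [ht.2]⟩)).comp_add_const t τ)
      (fun t ht => h.hasDerivAt_development (hI ⟨ht.1, by linarith [ht.2]⟩))
      (fun t ht => h.development_sq (hI ⟨by linarith [ht.1], by linarith [ht.2]⟩))
      (fun t ht => h.development_sq (hI ⟨ht.1, by linarith [ht.2]⟩)) hret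
  obtain ⟨c, hc, hc2⟩ : ∃ c ∈ Set.Icc a d, development α γ c 2 ≠ 0 := by
    by_contra! hcon
    exact hs (h.isStraight_of_height hα₀ had
      (fun t ht => hI ⟨ht.1, by linarith [ht.2]⟩) hcon)
  have hdev : development α γ (c + τ) = development α γ c := hper hc
  have hz : γ (c + τ) 2 = γ c 2 := by
    have e1 := h.development_zero_eq hI (t := c) ⟨hc.1, by linarith [hc.2]⟩
    have e2 := h.development_zero_eq hI (t := c + τ) ⟨by linarith [hc.1], by linarith [hc.2]⟩
    rw [hdev, e1, mul_right_inj' h0, Real.exp_eq_exp] at e2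
    linarith
  exact h.not_isLengthMinimizer_of_height hc.1 (by linarith) (by linarith [hc.2]) hI hz hdev hc2

end IsGeodesicOn

/-! ### Straight geodesics: the second variation -/

theorem IsStraight.sq (hα₀ : 0 < α) {V : Pt} (hV : IsStraight α V) :
    V 0 ^ 2 = α / (1 + α) ∧ V 1 ^ 2 = 1 / (1 + α) := by
  obtain ⟨h0, h1, -⟩ := hV
  rw [← sq_abs, h0, ← sq_abs (V 1), h1]
  simp only [unitVec, Matrix.cons_val, one_mul, div_pow, one_pow]
  rw [Real.sq_sqrt (by positivity), Real.sq_sqrt (by positivity)]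
  exact ⟨rfl, rfl⟩

theorem IsStraight.field_eq_zero (hα₀ : 0 < α) {V : Pt} (hV : IsStraight α V) :
    field α V = 0 := by
  obtain ⟨h0, h1⟩ := hV.sq hα₀
  have h2 := hV.2.2
  ext k
  fin_cases k <;> simp [field, h0, h1, h2]
  ring

/-- Second-order Taylor expansion with explicit cubic error. With `r = 2 * ε * S` and `r = -(2 * α *
ε * S)` the left side is the factor by which `wave` changes the squared `x`- and `y`-speeds. -/
theorem exp_neg_mul_sq_le {r s : ℝ} (hr : |r| ≤ s) (hs : s ≤ 1) :
    Real.exp (-r) * (1 + r) ^ 2 ≤ 1 + r - r ^ 2 / 2 + 2 * s ^ 3 := by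
  have hr1 : |r| ≤ 1 := hr.trans hs
  have h := Real.exp_bound (x := -r) (by rwa [abs_neg]) (n := 3) (by norm_num)
  simp [Finset.sum_range_succ, Nat.factorial] at h
  have h' := (abs_le.1 h).2
  have h3 : |r| ^ 3 ≤ s ^ 3 := pow_le_pow_left₀ (abs_nonneg r) hr 3
  have h4 : r ^ 4 ≤ |r| ^ 3 := by
    rw [← Even.pow_abs (by decide : Even 4), pow_succ]
    exact mul_le_of_le_one_right (by positivity) hr1
  have h5 : (1 + r) ^ 2 ≤ 4 := by
    have := abs_le.1 hr1
    nlinarith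
  have h6 : 0 ≤ |r| ^ 3 := by positivity
  have h7 := mul_le_mul_of_nonneg_right (show Real.exp (-r) ≤ 1 - r + r ^ 2 / 2 + |r| ^ 3 * (2 / 9)
    by linarith) (sq_nonneg (1 + r))
  nlinarith

/-- The oscillating competitor of the straight segment of length `L` from `p` whose velocity has
the `x`- and `y`-components `X` and `Y`. -/
def wave (α L ε : ℝ) (p : Pt) (X Y t : ℝ) : Pt :=
  ![p 0 + X * (t + 2 * ε / (2 * Real.pi / L) * (1 - Real.cos (2 * Real.pi / L * t))),
    p 1 + Y * (t - 2 * α * ε / (2 * Real.pi / L) * (1 - Real.cos (2 * Real.pi / L * t))),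
    p 2 + ε * Real.sin (2 * Real.pi / L * t)]

theorem contDiff_wave (α L ε : ℝ) (p : Pt) (X Y : ℝ) : ContDiff ℝ 1 (wave α L ε p X Y) := by
  refine contDiff_pi.2 fun k => ?_
  fin_cases k <;> simp [wave] <;> fun_prop

theorem hasDerivAt_wave {L : ℝ} (hL : 0 < L) (ε : ℝ) (p : Pt) (X Y t : ℝ) :
    HasDerivAt (wave α L ε p X Y) ![X * (1 + 2 * ε * Real.sin (2 * Real.pi / L * t)),
      Y * (1 - 2 * α * ε * Real.sin (2 * Real.pi / L * t)),
      ε * (2 * Real.pi / L) * Real.cos (2 * Real.pi / L * t)] t := by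
  have hω : 2 * Real.pi / L ≠ 0 := by have := Real.pi_pos; positivity
  set ω := 2 * Real.pi / L with hωd
  have hl : HasDerivAt (fun t => ω * t) ω t := by simpa using (hasDerivAt_id t).const_mul ω
  refine hasDerivAt_pi.2 fun k => ?_
  fin_cases k
  · simp only [wave, ← hωd]
    refine ((((hasDerivAt_id t).add ((hl.cos.const_sub 1).const_mul (2 * ε / ω))).const_mul
      X).const_add (p 0)).congr_deriv ?_
    simp
    field_simp
    simp
  · simp only [wave, ← hωd]
    refine ((((hasDerivAt_id t).sub ((hl.cos.const_sub 1).const_mul (2 * α * ε / ω))).const_mul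
      Y).const_add (p 1)).congr_deriv ?_
    simp
    field_simp
    simp
  · simp only [wave, ← hωd]
    refine ((hl.sin.const_mul ε).const_add (p 2)).congr_deriv ?_
    simp
    ring

/-- The horizontal speeds in `wave` follow `exp (2z)` and `exp (-2αz)` to first order, as
conservation of the two momenta suggests. With the weights `α/(1+α)` and `1/(1+α)` the linear terms
cancel, leaving `-2αε² sin²` against the vertical cost `ε²ω² cos²`. -/
theorem tangentNorm_wave_le (hα₀ : 0 < α) (hα₁ : α ≤ 1) {L ε : ℝ} (hL : 0 < L) (hε : 0 < ε)
    (hε1 : ε ≤ 1 / 2) (p : Pt) {V : Pt} (hV : IsStraight α V) (t : ℝ) :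
    tangentNorm α (wave α L ε p (Real.exp (p 2) * V 0) (Real.exp (-α * p 2) * V 1) t)
      (deriv (wave α L ε p (Real.exp (p 2) * V 0) (Real.exp (-α * p 2) * V 1)) t) ≤
    1 + 8 * ε ^ 3 - ε ^ 2 * (α / 2 - (2 * Real.pi / L) ^ 2 / 4)
      + ε ^ 2 * (α / 2 + (2 * Real.pi / L) ^ 2 / 4) * Real.cos (2 * (2 * Real.pi / L) * t) := by
  obtain ⟨hV0, hV1⟩ := hV.sq hα₀
  rw [(hasDerivAt_wave hL ε p _ _ t).deriv, tangentNorm_eq]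
  set ω := 2 * Real.pi / L with hω
  simp only [wave, Matrix.cons_val, ← hω]
  rw [mul_assoc 2 ω t, Real.cos_two_mul, Real.cos_sq']
  set S := Real.sin (ω * t) with hS
  have hC : Real.cos (ω * t) ^ 2 = 1 - S ^ 2 := Real.cos_sq' _
  have hS1 : |S| ≤ 1 := Real.abs_sin_le_one _
  have e0 : Real.exp (-2 * (p 2 + ε * S)) * (Real.exp (p 2) * V 0 * (1 + 2 * ε * S)) ^ 2 =
      α / (1 + α) * (Real.exp (-(2 * ε * S)) * (1 + 2 * ε * S) ^ 2) := by
    rw [← hV0, mul_pow, mul_pow, ← Real.exp_nat_mul,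
      show -(2 * ε * S) = -2 * (p 2 + ε * S) + (2 : ℕ) * p 2 by push_cast; ring, Real.exp_add]
    ring
  have e1 : Real.exp (2 * α * (p 2 + ε * S)) *
      (Real.exp (-α * p 2) * V 1 * (1 - 2 * α * ε * S)) ^ 2 =
      1 / (1 + α) * (Real.exp (-(-(2 * α * ε * S))) * (1 + -(2 * α * ε * S)) ^ 2) := by
    rw [← hV1, mul_pow, mul_pow, ← Real.exp_nat_mul, show -(-(2 * α * ε * S)) =
      2 * α * (p 2 + ε * S) + (2 : ℕ) * (-α * p 2) by push_cast; ring, Real.exp_add]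
    ring
  have b0 := exp_neg_mul_sq_le (r := 2 * ε * S) (s := 2 * ε) (by
    rw [abs_mul, abs_of_pos (by positivity)]
    exact mul_le_of_le_one_right (by positivity) hS1) (by linarith)
  have b1 := exp_neg_mul_sq_le (r := -(2 * α * ε * S)) (s := 2 * ε) (by
    rw [abs_neg, show 2 * α * ε * S = 2 * ε * (α * S) by ring, abs_mul,
      abs_of_pos (a := 2 * ε) (by positivity), abs_mul, abs_of_pos hα₀]
    exact mul_le_of_le_one_right (by positivity) (mul_le_one₀ hα₁ (abs_nonneg _) hS1))
    (by linarith)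
  rw [e0, e1]
  set N := α / (1 + α) * (Real.exp (-(2 * ε * S)) * (1 + 2 * ε * S) ^ 2) +
    1 / (1 + α) * (Real.exp (-(-(2 * α * ε * S))) * (1 + -(2 * α * ε * S)) ^ 2) +
    (ε * ω * Real.cos (ω * t)) ^ 2 with hN
  have hN0 : 0 ≤ N := by positivity
  -- The tangent line of the square root at `1` suffices, as `N` is `1` to first order in `ε`.
  have hsqrt : √N ≤ (1 + N) / 2 := by
    nlinarith [sq_nonneg (√N - 1), Real.sq_sqrt hN0]
  have hNle : N ≤ 1 + 16 * ε ^ 3 - 2 * α * ε ^ 2 * S ^ 2 + ε ^ 2 * ω ^ 2 * (1 - S ^ 2) := by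
    have c0 := mul_le_mul_of_nonneg_left b0 (show 0 ≤ α / (1 + α) by positivity)
    have c1 := mul_le_mul_of_nonneg_left b1 (show 0 ≤ 1 / (1 + α) by positivity)
    have hsum : α / (1 + α) * (1 + 2 * ε * S - (2 * ε * S) ^ 2 / 2 + 2 * (2 * ε) ^ 3) +
        1 / (1 + α) * (1 + -(2 * α * ε * S) - (-(2 * α * ε * S)) ^ 2 / 2 + 2 * (2 * ε) ^ 3) =
        1 + 16 * ε ^ 3 - 2 * α * ε ^ 2 * S ^ 2 := by
      field_simp
      ring
    rw [hN, mul_pow, mul_pow, hC]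
    linarith
  linarith

theorem length_wave_lt (hα₀ : 0 < α) (hα₁ : α ≤ 1) {L : ℝ} (hL : 0 < L)
    (hlt : (2 * Real.pi / L) ^ 2 < 2 * α) (p : Pt) {V : Pt} (hV : IsStraight α V) :
    ∃ ε, length α (wave α L ε p (Real.exp (p 2) * V 0) (Real.exp (-α * p 2) * V 1)) 0 L < L := by
  have hpi := Real.pi_pos
  set ω := 2 * Real.pi / L with hω
  set κ := α / 2 - ω ^ 2 / 4 with hκ
  have hκ0 : 0 < κ := by simp only [hκ]; linarith
  -- The choice `ε ≤ κ / 16` makes the cubic error `8 * ε ^ 3` at most half of the gain `ε ^ 2 * κ`.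
  set ε := min (1 / 2) (κ / 16) with hεd
  have hε : 0 < ε := by positivity
  have hε1 : ε ≤ 1 / 2 := min_le_left _ _
  have hε2 : ε ≤ κ / 16 := min_le_right _ _
  refine ⟨ε, ?_⟩
  set B := ε ^ 2 * (α / 2 + ω ^ 2 / 4) with hB
  have hω0 : ω ≠ 0 := by positivity
  have hint : ∫ t in (0 : ℝ)..L, (1 + 8 * ε ^ 3 - ε ^ 2 * κ + B * Real.cos (2 * ω * t)) =
      (1 + 8 * ε ^ 3 - ε ^ 2 * κ) * L := by
    rw [intervalIntegral.integral_eq_sub_of_hasDerivAt (f := fun t =>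
      (1 + 8 * ε ^ 3 - ε ^ 2 * κ) * t + B / (2 * ω) * Real.sin (2 * ω * t)) (fun t _ => ?_)
      (Continuous.intervalIntegrable (by fun_prop) _ _)]
    · have : Real.sin (2 * ω * L) = 0 := by
        rw [show 2 * ω * L = (4 : ℕ) * Real.pi by simp only [hω]; push_cast; field_simp; ring]
        exact Real.sin_nat_mul_pi 4
      simp [this]
    · refine (((hasDerivAt_id t).const_mul _).add
        ((((hasDerivAt_id t).const_mul (2 * ω)).sin).const_mul _)).congr_deriv ?_
      simp
      field_simp
  have hw := contDiff_wave α L ε p (Real.exp (p 2) * V 0) (Real.exp (-α * p 2) * V 1)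
  calc length α (wave α L ε p (Real.exp (p 2) * V 0) (Real.exp (-α * p 2) * V 1)) 0 L
      ≤ (1 + 8 * ε ^ 3 - ε ^ 2 * κ) * L := by
        rw [← hint]
        exact intervalIntegral.integral_mono_on hL.le
          (continuousOn_tangentNorm hw.continuous.continuousOn
            (hw.continuous_deriv le_rfl).continuousOn).intervalIntegrable
          (Continuous.intervalIntegrable (by fun_prop) _ _)
          fun t _ => tangentNorm_wave_le hα₀ hα₁ hL hε hε1 p hV t
    _ < L := by
        have : 0 < ε ^ 2 * (κ - 8 * ε) := mul_pos (by positivity) (by linarith)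
        nlinarith

theorem wave_zero (α L ε : ℝ) (p : Pt) (X Y : ℝ) : wave α L ε p X Y 0 = p := by
  ext k
  fin_cases k <;> simp [wave]

theorem wave_self {L : ℝ} (hL : L ≠ 0) (ε : ℝ) (p : Pt) (X Y : ℝ) :
    wave α L ε p X Y L = ![p 0 + X * L, p 1 + Y * L, p 2] := by
  ext k
  fin_cases k <;> simp [wave, hL]

namespace IsGeodesicOn

variable {γ : ℝ → Pt} {I : Set ℝ}

/-- `field` vanishes at a straight direction, so by uniqueness the development is constant; then the
height and the coordinate velocities are constant too. This matches the endpoint of `wave`. -/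
theorem eq_of_isStraight (h : IsGeodesicOn α γ I) (hα₀ : 0 < α) {a b : ℝ} (hab : a ≤ b)
    (hI : Set.Icc a b ⊆ I) (hV : IsStraight α (development α γ a)) :
    γ b = ![γ a 0 + Real.exp (γ a 2) * development α γ a 0 * (b - a),
      γ a 1 + Real.exp (-α * γ a 2) * development α γ a 1 * (b - a), γ a 2] := by
  set V := development α γ a with hVd
  have haI : a ∈ Set.Icc a b := Set.left_mem_Icc.2 hab
  have hconst : Set.EqOn (development α γ) (fun _ => V) (Set.Icc a b) :=
    eqOn_of_flowlines (fun t ht => h.hasDerivAt_development (hI ht))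
      (fun t _ => by rw [hV.field_eq_zero hα₀]; exact hasDerivAt_const t V)
      (fun t ht => h.development_sq (hI ht)) (fun t _ => h.development_sq (hI haI)) rfl
  have key : ∀ (k : Fin 3) (m : ℝ), (∀ t ∈ Set.Icc a b, deriv γ t k = m) →
      γ b k = γ a k + m * (b - a) := fun k m hm => by
    have hd : ∀ t ∈ Set.Icc a b, HasDerivAt (fun t => γ t k - m * t) 0 t := fun t ht => by
      refine ((hasDerivAt_pi.1 (h.hasDerivAt (hI ht)) k).sub
        ((hasDerivAt_id t).const_mul m)).congr_deriv ?_
      simp [hm t ht]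
    have := constant_of_has_deriv_right_zero
      (fun s hs => (hd s hs).continuousAt.continuousWithinAt)
      (fun s hs => (hd s (Set.Ico_subset_Icc_self hs)).hasDerivWithinAt) b
      (Set.right_mem_Icc.2 hab)
    linarith
  have hz : ∀ t ∈ Set.Icc a b, γ t 2 = γ a 2 := fun t ht => by
    have h0 : V 0 ≠ 0 := fun h0 => by
      have := (hV.sq hα₀).1
      rw [h0] at this
      have : 0 < α / (1 + α) := by positivity
      simp_all
    have := h.development_zero_eq hI ht
    rw [hconst ht, ← hVd, eq_comm, mul_eq_left₀ h0, Real.exp_eq_one_iff] at this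
    linarith
  have hu : ∀ t ∈ Set.Icc a b, ![Real.exp (-γ a 2) * deriv γ t 0,
      Real.exp (α * γ a 2) * deriv γ t 1, deriv γ t 2] = V := fun t ht => by
    rw [← hz t ht, ← development_eq, hconst ht]
  ext k
  fin_cases k
  · refine key 0 _ fun t ht => ?_
    rw [← hu t ht]
    simp only [Matrix.cons_val]
    rw [← mul_assoc, ← Real.exp_add]
    simp
  · refine key 1 _ fun t ht => ?_
    rw [← hu t ht]
    simp only [Matrix.cons_val]
    rw [← mul_assoc, ← Real.exp_add]
    simp
  · exact hz b (Set.right_mem_Icc.2 hab)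

/-- A straight geodesic longer than the limit of the periods is not a minimizer. -/
theorem not_isLengthMinimizer_of_isStraight (h : IsGeodesicOn α γ I) (hα₀ : 0 < α) (hα₁ : α ≤ 1)
    {a b : ℝ} (hab : a < b) (hI : Set.Icc a b ⊆ I) (hV : IsStraight α (development α γ a))
    (hlt : (2 * Real.pi / (b - a)) ^ 2 < 2 * α) : ¬ IsLengthMinimizer α γ a b := by
  intro hmin
  have hL : 0 < b - a := sub_pos.2 hab
  obtain ⟨ε, hε⟩ := length_wave_lt hα₀ hα₁ hL hlt (γ a) hV
  have hj := joins_of_contDiffOn (α := α) isOpen_univ (contDiff_wave α (b - a) ε (γ a)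
    (Real.exp (γ a 2) * development α γ a 0) (Real.exp (-α * γ a 2) * development α γ a 1)).contDiffOn
    hL.le (Set.subset_univ _)
  rw [wave_zero, wave_self hL.ne', ← h.eq_of_isStraight hα₀ hab.le hI hV] at hj
  have := hmin.length_le hab hj
  rw [h.length_eq hab.le hI] at this
  linarith

end IsGeodesicOn

end SolFamily

end

/-! ### The three cases of the period -/

theorem corollary3p12 (α : ℝ) (hα₀ : 0 < α) (hα₁ : α ≤ 1) (γ : ℝ → SolFamily.Pt) (a b : ℝ)
    (hγ : SolFamily.IsGeodesicSegment α γ a b) (hlarge : SolFamily.IsLarge α γ a b) :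
    ¬ SolFamily.IsLengthMinimizer α γ a b := by
  obtain ⟨I, hI, h⟩ := SolFamily.isGeodesicSegment_iff.1 hγ
  -- The order of `a` and `b` is not given: `ENNReal.ofReal` truncates at `0`, so largeness forces a
  -- positive length, and hence `a < b`.
  have hlen : 0 < SolFamily.length α γ a b := by
    by_contra hcon
    simp [SolFamily.IsLarge, ENNReal.ofReal_of_nonpos (not_lt.1 hcon)] at hlarge
  have hab : a < b := by
    by_contra hcon
    have := SolFamily.length_nonneg α γ (not_lt.1 hcon)
    rw [SolFamily.length, intervalIntegral.integral_symm] at hlen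
    rw [SolFamily.length] at this
    linarith
  rw [SolFamily.IsLarge, h.length_eq hab.le hI] at hlarge
  have hL : 0 < b - a := sub_pos.2 hab
  unfold SolFamily.period at hlarge
  split_ifs at hlarge with h0 hs
  · exact absurd hlarge not_top_lt
  · have hlt := (SolFamily.le_liminf_returnTime hα₀ hα₁).trans_lt hlarge
    rw [ENNReal.ofReal_lt_ofReal_iff hL, div_lt_iff₀ (Real.sqrt_pos.2 (by linarith)),
      ← div_lt_iff₀' hL] at hlt
    have hpi := Real.pi_pos
    exact h.not_isLengthMinimizer_of_isStraight hα₀ hα₁ hab hI hs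
      ((Real.lt_sqrt (by positivity)).1 hlt)
  · push Not at h0
    simp only [SolFamily.returnTime, iInf_lt_iff] at hlarge
    obtain ⟨τ, ⟨hτ, γ₀, hγ₀, -, hd0, hdτ⟩, hlt⟩ := hlarge
    rw [ENNReal.ofReal_lt_ofReal_iff hL] at hlt
    obtain ⟨I₀, hI₀, h₀⟩ := SolFamily.isGeodesicSegment_iff.1 hγ₀
    refine h.not_isLengthMinimizer_of_return hα₀ hτ hlt hI ?_ h0.1 hs
    have hmem : ∀ t ∈ Set.Icc 0 τ, a + t ∈ I := fun t ht =>
      hI ⟨by linarith [ht.1], by linarith [ht.2]⟩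
    -- The return is witnessed by a geodesic `γ₀` from the identity; the flow is autonomous, so the
    -- development of `γ` shifted by `a` agrees with that of `γ₀`. Any return time below `b - a`
    -- will do, whether or not the infimum is attained.
    have := SolFamily.eqOn_of_flowlines (u := fun t => SolFamily.development α γ (a + t))
      (v := SolFamily.development α γ₀)
      (fun t ht => (h.hasDerivAt_development (hmem t ht)).comp_const_add a t)
      (fun t ht => h₀.hasDerivAt_development (hI₀ ht))
      (fun t ht => h.development_sq (hmem t ht))
      (fun t ht => h₀.development_sq (hI₀ ht)) (by simp [hd0]) (Set.right_mem_Icc.2 hτ.le)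
    exact this.trans hdτ
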